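/- For every finite group $G$ there exist a finite group $\widetilde G$ and a surjective group homomorphism $\varphi\colon \widetilde G\to G$ such that for any two non-conjugate subgroups $G_1, G_2\le G$ (that is, subgroups for which there is no $g\in G$ with $gG_1g^{-1}=G_2$), the preimages $\varphi^{-1}(G_1)$ and $\varphi^{-1}(G_2)$ are not isomorphic as groups. Moreover, $\widetilde G$ and $\varphi$ can be chosen so that, in addition, the kernel $N=\ker\varphi$ is supersolvable, i.e. there is a finite series $1=N_0\le N_1\le\dots\le N_n=N$ of normal subgroups $N_i$ of $N$ with every quotient $N_{i+1}/N_i$ cyclic; in particular, if $G$ is solvable, then so is $\widetilde G$. -/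

import Mathlib

universe u

/-- A group `H` is supersolvable if it has a finite series
`1 = s 0 ≤ s 1 ≤ ... ≤ s n = H` whose terms are all normal in the whole group `H`
and whose successive quotients `s (i + 1) / s i` are cyclic. -/
def IsSupersolvable (H : Type u) [Group H] : Prop :=
  ∃ (n : ℕ) (s : ℕ → Subgroup H) (_ : ∀ i, (s i).Normal),
    s 0 = ⊥ ∧ s n = ⊤ ∧
      ∀ i < n, s i ≤ s (i + 1) ∧ IsCyclic (s (i + 1) ⧸ (s i).subgroupOf (s (i + 1)))

/-- Two subgroups of `G` are conjugate if `g A g⁻¹ = B` for some `g` in `G`. -/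
def AreConjugateSubgroups {G : Type u} [Group G] (A B : Subgroup G) : Prop :=
  ∃ g : G, A.map (MulAut.conj g).toMonoidHom = B

/-! The extension is rigid: an isomorphism between preimages of subgroups must come from conjugation
in `G`. Since `q` and the distinct primes `p s` are coprime to `|G|`, torsion forces the image of
`T` into `V ⋊ T` and the image of each factor `V_s` into `V_s`. Comparing eigenvalues, the induced
map on `T` permutes the weights `t x + 2 * t (x * s)` for each `s`. These encode the edges `x → x *
s` of the Cayley graph, the coefficients 1 and 2 recording direction and `s` the colour. So the map
is a colour-preserving automorphism of that graph, that is, left translation by some `g`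
(`exists_translation`), and equivariance makes the isomorphism induce conjugation by `g`
(`exists_conj_le`). The kernel `V ⋊ T` is supersolvable because `T` acts diagonally on `V`. -/

/-- The iterated semidirect product `(V ⋊ T) ⋊ G`, where `T` is the module of functions
`G → ℤ/q` and `V` is the product over `s` of the modules of functions `G → ℤ/p s`. An element
`t` of `T` scales the coordinate `x` of the `s`-th factor of `V` by
`E s (t x + 2 * t (x * s))`, and `G` acts on all functions by left translation. -/
@[ext]
structure RigidExt {G : Type u} [Group G] (q : ℕ) (p : G → ℕ)
    (E : ∀ s, AddChar (ZMod q) (ZMod (p s))) where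
  v : ∀ s, G → ZMod (p s)
  t : G → ZMod q
  g : G

/-! ### Group structure of the extension -/

namespace RigidExt

variable {G : Type u} [Group G] {q : ℕ} {p : G → ℕ} {E : ∀ s, AddChar (ZMod q) (ZMod (p s))}

/-- The scalar by which `t` acts on the coordinate `x` of the `s`-th factor. -/
def weight (E : ∀ s, AddChar (ZMod q) (ZMod (p s))) (s x : G) (t : G → ZMod q) : ZMod (p s) :=
  E s (t x + 2 * t (x * s))

theorem weight_zero (s x : G) : weight E s x 0 = 1 := by
  simp [weight]

theorem weight_add (s x : G) (t t' : G → ZMod q) :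
    weight E s x (t + t') = weight E s x t * weight E s x t' := by
  simp only [weight, ← AddChar.map_add_eq_mul, Pi.add_apply]
  congr 1
  ring

instance : Mul (RigidExt q p E) where
  mul a b := ⟨fun s x => a.v s x + weight E s x a.t * b.v s (a.g⁻¹ * x),
    fun x => a.t x + b.t (a.g⁻¹ * x), a.g * b.g⟩

instance : One (RigidExt q p E) where
  one := ⟨0, 0, 1⟩

instance : Inv (RigidExt q p E) where
  inv a := ⟨fun s x => -(weight E s (a.g * x) (-a.t) * a.v s (a.g * x)),
    fun x => -a.t (a.g * x), a.g⁻¹⟩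

theorem mul_v (a b : RigidExt q p E) (s x : G) :
    (a * b).v s x = a.v s x + weight E s x a.t * b.v s (a.g⁻¹ * x) := rfl
theorem mul_t (a b : RigidExt q p E) (x : G) : (a * b).t x = a.t x + b.t (a.g⁻¹ * x) := rfl
theorem mul_g (a b : RigidExt q p E) : (a * b).g = a.g * b.g := rfl
theorem one_v : (1 : RigidExt q p E).v = 0 := rfl
theorem one_t : (1 : RigidExt q p E).t = 0 := rfl
theorem one_g : (1 : RigidExt q p E).g = 1 := rfl
theorem inv_v (a : RigidExt q p E) (s x : G) :
    a⁻¹.v s x = -(weight E s (a.g * x) (-a.t) * a.v s (a.g * x)) := rfl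
theorem inv_t (a : RigidExt q p E) (x : G) : a⁻¹.t x = -a.t (a.g * x) := rfl
theorem inv_g (a : RigidExt q p E) : a⁻¹.g = a.g⁻¹ := rfl

theorem weight_mul (a b : RigidExt q p E) (s x : G) :
    weight E s x (a * b).t = weight E s x a.t * weight E s (a.g⁻¹ * x) b.t := by
  simp only [weight, mul_t, ← AddChar.map_add_eq_mul, mul_assoc]
  congr 1
  ring

theorem weight_inv (a : RigidExt q p E) (s x : G) :
    weight E s x a⁻¹.t = weight E s (a.g * x) (-a.t) := by
  simp only [weight, inv_t, Pi.neg_apply, mul_assoc]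

instance : Group (RigidExt q p E) :=
  Group.ofLeftAxioms
    (by
      intro a b c
      ext s x
      · simp only [mul_v, weight_mul, mul_g, mul_inv_rev, mul_assoc]
        ring
      · simp only [mul_t, mul_g, mul_inv_rev, mul_assoc, add_assoc]
      · exact mul_assoc _ _ _)
    (by
      intro a
      ext s x
      · simp [mul_v, one_v, one_t, one_g, weight_zero]
      · simp [mul_t, one_t, one_g]
      · simp [mul_g, one_g])
    (by
      intro a
      ext s x
      · simp [mul_v, inv_v, one_v, weight_inv, inv_g]
      · simp [mul_t, inv_t, one_t, inv_g]
      · simp [mul_g, inv_g, one_g])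

instance [Finite G] [NeZero q] [∀ s, NeZero (p s)] : Finite (RigidExt q p E) :=
  Finite.of_injective
    (fun a : RigidExt q p E => ((a.v, a.t, a.g) : (∀ s, G → ZMod (p s)) × (G → ZMod q) × G))
    (fun a b h => by
      simp only [Prod.mk.injEq] at h
      exact RigidExt.ext h.1 h.2.1 h.2.2)

/-- The projection to `G`. -/
def proj : RigidExt q p E →* G where
  toFun := g
  map_one' := rfl
  map_mul' _ _ := rfl

theorem proj_apply (a : RigidExt q p E) : proj a = a.g := rfl

theorem proj_surjective : Function.Surjective (proj : RigidExt q p E →* G) :=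
  fun x => ⟨⟨0, 0, x⟩, rfl⟩

theorem pow_g (a : RigidExt q p E) (n : ℕ) : (a ^ n).g = a.g ^ n :=
  map_pow proj a n

theorem pow_t {a : RigidExt q p E} (ha : a.g = 1) (n : ℕ) : (a ^ n).t = n • a.t := by
  induction n with
  | zero => simp [one_t]
  | succ n ih => ext x; simp [pow_succ', mul_t, ih, ha, add_mul, add_comm]

theorem pow_v {a : RigidExt q p E} (ha : a.g = 1) (ht : a.t = 0) (n : ℕ) :
    (a ^ n).v = n • a.v := by
  induction n with
  | zero => simp [one_v]
  | succ n ih => ext s x; simp [pow_succ', mul_v, ih, ha, ht, weight_zero, add_mul, add_comm]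

/-! ### Rigidity of isomorphisms between preimages -/

/-- The element of `V` with single nonzero coordinate `x` in the `s`-th factor. -/
def line [DecidableEq G] (E : ∀ s, AddChar (ZMod q) (ZMod (p s))) (s x : G) : RigidExt q p E :=
  ⟨Pi.single s (Pi.single x 1), 0, 1⟩

/-- The inclusion of `T`. -/
def torus (E : ∀ s, AddChar (ZMod q) (ZMod (p s))) (t : G → ZMod q) : RigidExt q p E :=
  ⟨0, t, 1⟩

theorem torus_pow (t : G → ZMod q) : torus E t ^ q = 1 := by
  have key : ∀ n : ℕ, torus E t ^ n = torus E (n • t) := by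
    intro n
    induction n with
    | zero => ext <;> simp [torus, one_v, one_t, one_g]
    | succ n ih =>
      rw [pow_succ', ih]
      ext <;> simp [torus, mul_v, mul_t, mul_g, add_mul, add_comm]
  rw [key]
  ext <;> simp [torus, one_v, one_t, one_g]

theorem line_pow [DecidableEq G] (s x : G) : line E s x ^ p s = 1 := by
  have hv := pow_v (a := line E s x) rfl rfl (p s)
  have ht := pow_t (a := line E s x) rfl (p s)
  have hg := pow_g (line E s x) (p s)
  ext s' y
  · rw [hv]
    by_cases h : s' = s
    · subst h
      simp [line, one_v]
    · simp [line, one_v, h]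
  · rw [ht]; simp [line, one_t]
  · rw [hg]; simp [line, one_g]

theorem torus_conj_line [DecidableEq G] [∀ s, NeZero (p s)] (t : G → ZMod q) (s x : G) :
    torus E t * line E s x = line E s x ^ (weight E s x t).val * torus E t := by
  have hv := pow_v (a := line E s x) rfl rfl (weight E s x t).val
  have ht := pow_t (a := line E s x) rfl (weight E s x t).val
  have hg := pow_g (line E s x) (weight E s x t).val
  ext s' y
  · simp only [mul_v, hv]
    by_cases h : s' = s
    · subst h
      by_cases hy : y = x
      · subst hy
        simp [line, torus]
      · simp [line, torus, hy]
    · simp [line, torus, h]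
  · rw [mul_t, mul_t, ht, hg]; simp [line, torus]
  · rw [mul_g, mul_g, hg]; simp [line, torus]

theorem conj_torus (h : G) (t : G → ZMod q) :
    (⟨0, 0, h⟩ : RigidExt q p E) * torus E t =
      torus E (fun x => t (h⁻¹ * x)) * (⟨0, 0, h⟩ : RigidExt q p E) := by
  ext <;> simp [torus, mul_v, mul_t, mul_g]

theorem eq_one_of_pow_eq_one_of_coprime {H : Type*} [Group H] [Finite H] {n : ℕ}
    (hn : n.Coprime (Nat.card H)) {h : H} (hh : h ^ n = 1) : h = 1 :=
  (pow_eq_one_iff_of_coprime hn).1 ⟨hh, pow_card_eq_one'⟩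

/-- Multiplication by `p s` is injective on `ℤ/q` and on every other `ℤ/p s'`, and `p s` is coprime
to `|G|`. This is what makes homomorphisms into the extension respect the factors of `V`. -/
theorem pow_prime_eq_one [Finite G] [Fact q.Prime] [∀ s, Fact (p s).Prime]
    (hp : Function.Injective p) (hpq : ∀ s, p s ≠ q)
    (hpG : ∀ s, (p s).Coprime (Nat.card G)) {a : RigidExt q p E} {s : G} (ha : a ^ p s = 1) :
    a.g = 1 ∧ a.t = 0 ∧ ∀ s' ≠ s, a.v s' = 0 := by
  have hg : a.g = 1 :=
    eq_one_of_pow_eq_one_of_coprime (hpG s) (by rw [← pow_g, ha, one_g])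
  have ht : a.t = 0 := by
    have h := pow_t hg (p s)
    rw [ha, one_t] at h
    ext x
    have hx := congrFun h x
    simp only [Pi.zero_apply, Pi.smul_apply, nsmul_eq_mul, zero_eq_mul] at hx
    refine hx.resolve_left fun h0 => ?_
    rw [ZMod.natCast_eq_zero_iff, Nat.prime_dvd_prime_iff_eq Fact.out Fact.out] at h0
    exact hpq s h0.symm
  refine ⟨hg, ht, fun s' hs' => ?_⟩
  have h := pow_v hg ht (p s)
  rw [ha, one_v] at h
  ext x
  have hx := congrFun (congrFun h s') x
  simp only [Pi.zero_apply, Pi.smul_apply, nsmul_eq_mul, zero_eq_mul] at hx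
  refine hx.resolve_left fun h0 => ?_
  rw [ZMod.natCast_eq_zero_iff, Nat.prime_dvd_prime_iff_eq Fact.out Fact.out] at h0
  exact hs' (hp h0)

/-- The combinatorial core: a family of functionals that pulls every weight back to a weight
comes from a left translation. -/
theorem exists_translation [Finite G] [Fact q.Prime] (hq : 5 ≤ q)
    (τ : (G → ZMod q) → G → ZMod q)
    (hτ : ∀ s x, ∃ y, ∀ t, τ t y + 2 * τ t (y * s) = t x + 2 * t (x * s)) :
    ∃ g : G, ∀ t x, τ t (g * x) = t x := by
  classical
  have small : ∀ n : ℕ, 0 < n → n < 5 → (n : ZMod q) ≠ 0 := by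
    intro n h0 h5 h
    rw [ZMod.natCast_eq_zero_iff] at h
    exact absurd (Nat.le_of_dvd h0 h) (by omega)
  have h1 : (1 : ZMod q) ≠ 0 := one_ne_zero
  have h2 : (2 : ZMod q) ≠ 0 := by simpa using small 2 (by norm_num) (by norm_num)
  have h3 : (3 : ZMod q) ≠ 0 := by simpa using small 3 (by norm_num) (by norm_num)
  -- At `s = 1` both terms of the weight coincide, giving `3 * t x`, and 3 is invertible.
  have hπ : ∀ x, ∃ y, ∀ t, τ t y = t x := by
    intro x
    obtain ⟨y, hy⟩ := hτ 1 x
    refine ⟨y, fun t => mul_left_cancel₀ h3 ?_⟩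
    have := hy t
    simp only [mul_one] at this
    linear_combination this
  choose π hπ using hπ
  have hinj : Function.Injective π := by
    intro x y h
    by_contra hxy
    have := (hπ x (Pi.single x 1)).symm.trans (h ▸ hπ y (Pi.single x 1))
    simp [Ne.symm hxy] at this
  have hsurj := Finite.surjective_of_injective hinj
  -- Indicator functions separate the two endpoints of an edge, since 1, 2 and 3 are nonzero in
  -- `ℤ/q`.
  have hmul : ∀ x s, π x * s = π (x * s) := by
    intro x s
    obtain ⟨y, hy⟩ := hτ s x
    obtain ⟨a, rfl⟩ := hsurj y
    obtain ⟨b, hb⟩ := hsurj (π a * s)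
    simp only [← hb, hπ] at hy
    have hax : a = x := by
      by_contra hax
      have h := hy (Pi.single a 1)
      by_cases hb' : b = a <;> by_cases hs : x * s = a <;>
        simp [hb', hs, Ne.symm hax] at h
      · exact h3 (by linear_combination h)
      · exact h1 (by linear_combination -h)
    subst hax
    have hbs : b = a * s := by
      by_contra hbs
      have h := hy (Pi.single b 1)
      simp [Ne.symm hbs, h2] at h
    rw [← hb, hbs]
  refine ⟨π 1, fun t x => ?_⟩
  rw [hmul, one_mul, hπ]

theorem exists_conj_le [Finite G] [Fact q.Prime] [∀ s, Fact (p s).Prime] (hq : 5 ≤ q)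
    (hE : ∀ s, Function.Injective (E s)) (hp : Function.Injective p) (hpq : ∀ s, p s ≠ q)
    (hpG : ∀ s, (p s).Coprime (Nat.card G)) (hqG : q.Coprime (Nat.card G))
    {G₁ G₂ : Subgroup G}
    (Φ : G₁.comap (proj : RigidExt q p E →* G) ≃* G₂.comap (proj : RigidExt q p E →* G)) :
    ∃ g : G, G₁.map (MulAut.conj g).toMonoidHom ≤ G₂ := by
  classical
  let T : (G → ZMod q) → G₁.comap (proj : RigidExt q p E →* G) :=
    fun t => ⟨torus E t, by simp [Subgroup.mem_comap, proj_apply, torus]⟩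
  let L : G → G → G₁.comap (proj : RigidExt q p E →* G) :=
    fun s x => ⟨line E s x, by simp [Subgroup.mem_comap, proj_apply, line]⟩
  let F : G₁.comap (proj : RigidExt q p E →* G) →* RigidExt q p E :=
    (Subgroup.subtype _).comp Φ.toMonoidHom
  have hF : Function.Injective F := Subtype.val_injective.comp Φ.injective
  have hTg : ∀ t, (F (T t)).g = 1 := by
    intro t
    refine eq_one_of_pow_eq_one_of_coprime hqG ?_
    have h : T t ^ q = 1 := Subtype.ext (torus_pow t)
    rw [← pow_g, ← map_pow, h, map_one, one_g]
  obtain ⟨g, hg⟩ := exists_translation hq (fun t => (F (T t)).t) (by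
    intro s x
    have hpow : F (L s x) ^ p s = 1 := by
      have h : L s x ^ p s = 1 := Subtype.ext (line_pow s x)
      rw [← map_pow, h, map_one]
    obtain ⟨ug, ut, uv⟩ := pow_prime_eq_one hp hpq hpG hpow
    -- On any nonzero coordinate `y` of the image eigenvector, the eigenvalue of `F (T t)` must be
    -- the original weight at `x`.
    obtain ⟨y, hy⟩ : ∃ y, (F (L s x)).v s y ≠ 0 := by
      by_contra! h
      have h1 : F (L s x) = F 1 := by
        rw [map_one]
        refine RigidExt.ext (funext fun s' => ?_) ut ug
        by_cases hs : s' = s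
        · subst hs; exact funext h
        · exact uv s' hs
      have h2 := congrArg (fun a => a.1.v s x) (hF h1)
      simp [L, line, one_v] at h2
    refine ⟨y, fun t => hE s ?_⟩
    have hc : T t * L s x = L s x ^ (weight E s x t).val * T t :=
      Subtype.ext (torus_conj_line t s x)
    have hc' := congrArg F hc
    rw [map_mul, map_mul, map_pow] at hc'
    have hv := congrArg (fun a => a.v s y) hc'
    simp only [mul_v, pow_v ug ut, pow_t ug, pow_g, ug, ut, hTg, one_pow, inv_one, one_mul,
      smul_zero, weight_zero, Pi.smul_apply, nsmul_eq_mul, ZMod.natCast_val, ZMod.cast_id',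
      id_eq] at hv
    refine mul_right_cancel₀ hy ?_
    rw [add_comm] at hv
    exact add_right_cancel hv)
  refine ⟨g, ?_⟩
  rintro _ ⟨h, hh, rfl⟩
  let H : G₁.comap (proj : RigidExt q p E →* G) := ⟨⟨0, 0, h⟩, hh⟩
  suffices hs : (F H).g = g * h * g⁻¹ by
    have := (Φ H).2
    rw [Subgroup.mem_comap, proj_apply] at this
    change (F H).g ∈ G₂ at this
    rw [hs] at this
    simpa using this
  -- Apply `F` to the relation expressing how `h` translates `T`, and read off the `T`-component at
  -- `g`.
  have hx : (F H).g⁻¹ * g = g * h⁻¹ := by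
    have key : ∀ t : G → ZMod q, t (g⁻¹ * ((F H).g⁻¹ * g)) = t h⁻¹ := by
      intro t
      have hc : H * T t = T (fun x => t (h⁻¹ * x)) * H := Subtype.ext (conj_torus h t)
      have hc' := congrArg F hc
      rw [map_mul, map_mul] at hc'
      have ht := congrArg (fun a => a.t g) hc'
      simp only [mul_t, hTg, inv_one, one_mul] at ht
      have e1 := hg t (g⁻¹ * ((F H).g⁻¹ * g))
      have e2 := hg (fun x => t (h⁻¹ * x)) 1
      simp only [mul_one, mul_inv_cancel_left] at e1 e2
      rw [e1, e2, add_comm] at ht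
      exact add_right_cancel ht
    by_contra hne
    have hk := key (Pi.single h⁻¹ 1)
    have hne' : g⁻¹ * ((F H).g⁻¹ * g) ≠ h⁻¹ := fun e => hne (by rw [← e, mul_inv_cancel_left])
    simp [hne'] at hk
  have h' := congrArg (fun z => g * z⁻¹) hx
  simp only [mul_inv_rev, inv_inv] at h'
  rw [mul_inv_cancel_left] at h'
  rw [h', mul_assoc]

/-! ### Supersolvability and solvability -/

theorem mem_ker_proj {a : RigidExt q p E} : a ∈ (proj : RigidExt q p E →* G).ker ↔ a.g = 1 :=
  Iff.rfl

/-- The `i`-th term of the coordinate filtration of the kernel, the coordinates of `V` being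
numbered before those of `T`. -/
def level {m k : ℕ} (e : G × G ≃ Fin m) (e' : G ≃ Fin k) (i : ℕ) :
    Subgroup (proj : RigidExt q p E →* G).ker where
  carrier := {a | (∀ s x, i ≤ (e (s, x) : ℕ) → a.1.v s x = 0) ∧
    ∀ x, i ≤ m + (e' x : ℕ) → a.1.t x = 0}
  one_mem' := ⟨fun _ _ _ => rfl, fun _ _ => rfl⟩
  mul_mem' {a b} ha hb := by
    have hg := mem_ker_proj.1 a.2
    refine ⟨fun s x h => ?_, fun x h => ?_⟩
    · simp [mul_v, hg, ha.1 s x h, hb.1 s x h]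
    · simp [mul_t, hg, ha.2 x h, hb.2 x h]
  inv_mem' {a} ha := by
    have hg := mem_ker_proj.1 a.2
    refine ⟨fun s x h => ?_, fun x h => ?_⟩
    · simp [inv_v, hg, ha.1 s x h]
    · simp [inv_t, hg, ha.2 x h]

/-- Below `m` a term lies in the abelian group `V`, and conjugation only rescales its coordinates;
from `m` on it contains `V`, modulo which the kernel is abelian. -/
theorem level_normal {m k : ℕ} (e : G × G ≃ Fin m) (e' : G ≃ Fin k) (i : ℕ) :
    (level e e' i : Subgroup (proj : RigidExt q p E →* G).ker).Normal := by
  refine ⟨fun n hn a => ?_⟩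
  have ha := mem_ker_proj.1 a.2
  have hng := mem_ker_proj.1 n.2
  refine ⟨fun s x h => ?_, fun x h => ?_⟩
  · have hnt : n.1.t = 0 := funext fun y => hn.2 y (by have := (e (s, x)).2; omega)
    have hw : weight E s x a.1.t * weight E s x (-a.1.t) = 1 := by
      rw [← weight_add, add_neg_cancel, weight_zero]
    simp only [Subgroup.coe_mul, Subgroup.coe_inv, mul_v, inv_v, mul_g, weight_mul, ha, hng, hnt,
      hn.1 s x h, weight_zero, inv_one, one_mul, mul_one, mul_zero, add_zero]
    linear_combination -a.1.v s x * hw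
  · simp [mul_t, inv_t, mul_g, ha, hng, hn.2 x h]

theorem isCyclic_quotient_of_ker_eq {H C : Type*} [Group H] [Group C] [IsCyclic C]
    (S : Subgroup H) [S.Normal] (f : H →* C) (hf : f.ker = S) : IsCyclic (H ⧸ S) := by
  subst hf
  exact isCyclic_of_injective _ (QuotientGroup.kerLift_injective f)

theorem isCyclic_level_quotient {m k : ℕ} (e : G × G ≃ Fin m) (e' : G ≃ Fin k) {i : ℕ}
    (hi : i < m + k) :
    letI := level_normal (E := E) e e' i
    IsCyclic ((level e e' (i + 1) : Subgroup (proj : RigidExt q p E →* G).ker) ⧸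
      (level e e' i).subgroupOf (level e e' (i + 1))) := by
  have := level_normal (E := E) e e' i
  by_cases him : i < m
  · obtain ⟨⟨s, x⟩, hsx⟩ := e.surjective ⟨i, him⟩
    have hei : (e (s, x) : ℕ) = i := by rw [hsx]
    have ht : ∀ a ∈ (level e e' (i + 1) : Subgroup (proj : RigidExt q p E →* G).ker),
        a.1.t = 0 := fun a ha => funext fun y => ha.2 y (by omega)
    let f : (level e e' (i + 1) : Subgroup (proj : RigidExt q p E →* G).ker) →*
        Multiplicative (ZMod (p s)) :=
      { toFun := fun a => Multiplicative.ofAdd (a.1.1.v s x)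
        map_one' := rfl
        map_mul' := fun a b => by
          rw [← ofAdd_add]
          simp [mul_v, ht a.1 a.2, mem_ker_proj.1 a.1.2, weight_zero] }
    refine isCyclic_quotient_of_ker_eq _ f (Subgroup.ext fun a => ?_)
    rw [MonoidHom.mem_ker, Subgroup.mem_subgroupOf]
    refine ⟨fun h => ⟨fun s' x' hs => ?_, fun y _ => congrFun (ht a.1 a.2) y⟩, fun h =>
      congrArg Multiplicative.ofAdd (h.1 s x hei.ge)⟩
    rcases hs.eq_or_lt with heq | hlt
    · obtain ⟨rfl, rfl⟩ := Prod.mk.inj (e.injective (Fin.ext (heq.symm.trans hei.symm)))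
      exact congrArg Multiplicative.toAdd h
    · exact a.2.1 s' x' hlt
  · obtain ⟨x, hx⟩ := e'.surjective ⟨i - m, by omega⟩
    have hei : m + (e' x : ℕ) = i := by rw [hx]; simp only; omega
    let f : (level e e' (i + 1) : Subgroup (proj : RigidExt q p E →* G).ker) →*
        Multiplicative (ZMod q) :=
      { toFun := fun a => Multiplicative.ofAdd (a.1.1.t x)
        map_one' := rfl
        map_mul' := fun a b => by
          rw [← ofAdd_add]
          simp [mul_t, mem_ker_proj.1 a.1.2] }
    refine isCyclic_quotient_of_ker_eq _ f (Subgroup.ext fun a => ?_)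
    rw [MonoidHom.mem_ker, Subgroup.mem_subgroupOf]
    refine ⟨fun h => ⟨fun s' x' hs => ?_, fun y hy => ?_⟩, fun h =>
      congrArg Multiplicative.ofAdd (h.2 x hei.ge)⟩
    · have := (e (s', x')).2
      omega
    · rcases hy.eq_or_lt with heq | hlt
      · obtain rfl := e'.injective (Fin.ext (Nat.add_left_cancel (heq.symm.trans hei.symm)))
        exact congrArg Multiplicative.toAdd h
      · exact a.2.2 y hlt

theorem isSupersolvable_ker_proj [Finite G] :
    IsSupersolvable (proj : RigidExt q p E →* G).ker := by
  obtain ⟨m, ⟨e⟩⟩ := Finite.exists_equiv_fin (G × G)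
  obtain ⟨k, ⟨e'⟩⟩ := Finite.exists_equiv_fin G
  refine ⟨m + k, level e e', level_normal e e', ?_, ?_, fun i hi => ⟨?_, ?_⟩⟩
  · refine (Subgroup.eq_bot_iff_forall _).2 fun a ha => Subtype.ext (RigidExt.ext ?_ ?_ a.2)
    · exact funext₂ fun s x => ha.1 s x (Nat.zero_le _)
    · exact funext fun x => ha.2 x (Nat.zero_le _)
  · refine (Subgroup.eq_top_iff' _).2 fun a => ⟨fun s x h => ?_, fun x h => ?_⟩
    · have := (e (s, x)).2
      omega
    · have := (e' x).2
      omega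
  · exact fun a ha => ⟨fun s x h => ha.1 s x (by omega), fun x h => ha.2 x (by omega)⟩
  · exact isCyclic_level_quotient e e' hi

/-- The projection of the kernel `V ⋊ T` to `T`. -/
def kerToTorus : (proj : RigidExt q p E →* G).ker →* Multiplicative (G → ZMod q) where
  toFun a := Multiplicative.ofAdd a.1.t
  map_one' := rfl
  map_mul' a b := by
    rw [← ofAdd_add]
    congr 1
    ext x
    simp [mul_t, mem_ker_proj.1 a.2]

theorem isSolvable [Group.IsSolvable G] : Group.IsSolvable (RigidExt q p E) := by
  have h1 : Group.IsSolvable (kerToTorus (E := E)).ker := Group.isSolvable_of_comm fun a b => by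
    have ha : a.1.1.t = 0 := congrArg Multiplicative.toAdd a.2
    have hb : b.1.1.t = 0 := congrArg Multiplicative.toAdd b.2
    refine Subtype.ext (Subtype.ext ?_)
    ext s x <;>
      simp [mul_v, mul_t, mul_g, ha, hb, mem_ker_proj.1 a.1.2, mem_ker_proj.1 b.1.2, weight_zero,
        add_comm]
  have h2 : Group.IsSolvable (proj : RigidExt q p E →* G).ker :=
    Group.isSolvable_of_ker_le_range (kerToTorus (E := E)).ker.subtype kerToTorus
      (Subgroup.range_subtype _).ge
  exact Group.isSolvable_of_ker_le_range (proj : RigidExt q p E →* G).ker.subtype proj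
    (Subgroup.range_subtype _).ge

theorem areConjugateSubgroups_of_mulEquiv [Finite G] [Fact q.Prime] [∀ s, Fact (p s).Prime]
    (hq : 5 ≤ q) (hE : ∀ s, Function.Injective (E s)) (hp : Function.Injective p)
    (hpq : ∀ s, p s ≠ q) (hpG : ∀ s, (p s).Coprime (Nat.card G)) (hqG : q.Coprime (Nat.card G))
    {G₁ G₂ : Subgroup G}
    (Φ : G₁.comap (proj : RigidExt q p E →* G) ≃* G₂.comap (proj : RigidExt q p E →* G)) :
    AreConjugateSubgroups G₁ G₂ := by
  obtain ⟨g, hg⟩ := exists_conj_le hq hE hp hpq hpG hqG Φ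
  obtain ⟨g', hg'⟩ := exists_conj_le hq hE hp hpq hpG hqG Φ.symm
  -- The reverse inclusion from `Φ.symm` may use a different conjugator, so only cardinalities are
  -- compared.
  have hc := Subgroup.card_le_of_le hg'
  rw [Subgroup.card_map_of_injective (MulAut.conj g').injective] at hc
  refine ⟨g, Subgroup.eq_of_le_of_card_ge hg ?_⟩
  rwa [Subgroup.card_map_of_injective (MulAut.conj g).injective]

end RigidExt

/-! ### Choice of primes and characters -/

theorem exists_injective_addChar {q p : ℕ} [Fact q.Prime] [Fact p.Prime] (h : p ≡ 1 [MOD q]) :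
    ∃ E : AddChar (ZMod q) (ZMod p), Function.Injective E := by
  have hdvd : q ∣ Nat.card (ZMod p)ˣ := by
    rw [Nat.card_eq_fintype_card, ZMod.card_units]
    exact (Nat.modEq_iff_dvd' (Nat.Prime.one_le Fact.out)).1 h.symm
  obtain ⟨z, hz⟩ := exists_prime_orderOf_dvd_card' q hdvd
  have hprim : IsPrimitiveRoot (z : ZMod p) q := by
    rw [← hz, ← orderOf_units]
    exact IsPrimitiveRoot.orderOf _
  refine ⟨AddChar.zmodChar q hprim.pow_eq_one, fun a b hab => ?_⟩
  rw [AddChar.zmodChar_apply, AddChar.zmodChar_apply] at hab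
  exact ZMod.val_injective q (hprim.pow_inj a.val_lt b.val_lt hab)

theorem exists_injective_primes_modEq_one (α : Type*) [Finite α] {q : ℕ} (hq : q ≠ 0) (n : ℕ) :
    ∃ p : α → ℕ, Function.Injective p ∧ ∀ s, (p s).Prime ∧ n < p s ∧ p s ≡ 1 [MOD q] := by
  have hinf : {r : ℕ | r.Prime ∧ n < r ∧ r ≡ 1 [MOD q]}.Infinite := by
    refine Set.infinite_of_not_bddAbove ?_
    rintro ⟨B, hB⟩
    obtain ⟨r, hr, hlt, hmod⟩ := Nat.exists_prime_gt_modEq_one (max n B) hq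
    exact absurd (hB ⟨hr, (le_max_left _ _).trans_lt hlt, hmod⟩)
      (not_le.2 ((le_max_right _ _).trans_lt hlt))
  obtain ⟨k, ⟨e⟩⟩ := Finite.exists_equiv_fin α
  refine ⟨fun s => hinf.natEmbedding _ (e s), fun s s' h => ?_, fun s =>
    (hinf.natEmbedding _ (e s)).2⟩
  exact e.injective (Fin.ext ((hinf.natEmbedding _).injective (Subtype.ext h)))

theorem mainTheorem1 (G : Type u) [Group G] [Finite G] :
    ∃ (Gt : Type u) (_ : Group Gt) (_ : Finite Gt) (φ : Gt →* G),
      Function.Surjective φ ∧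
      (∀ G₁ G₂ : Subgroup G, ¬ AreConjugateSubgroups G₁ G₂ →
        IsEmpty (G₁.comap φ ≃* G₂.comap φ)) ∧
      IsSupersolvable φ.ker ∧
      (Group.IsSolvable G → Group.IsSolvable Gt) := by
  -- The bound gives both `5 ≤ q` and coprimality to `|G|`; taking each `p s` above `q` gives the
  -- rest.
  obtain ⟨q, hq, hqp⟩ := Nat.exists_infinite_primes (Nat.card G + 5)
  obtain ⟨p, hp, hp'⟩ := exists_injective_primes_modEq_one G hqp.ne_zero q
  have : Fact q.Prime := ⟨hqp⟩
  have : ∀ s, Fact (p s).Prime := fun s => ⟨(hp' s).1⟩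
  choose E hE using fun s => exists_injective_addChar (hp' s).2.2
  have hcop : ∀ r : ℕ, r.Prime → q ≤ r → r.Coprime (Nat.card G) := fun r hr hle =>
    (Nat.coprime_of_lt_prime Nat.card_pos.ne' (by omega) hr)
  refine ⟨RigidExt q p E, inferInstance, inferInstance, RigidExt.proj, RigidExt.proj_surjective,
    fun G₁ G₂ h => ⟨fun Φ => h ?_⟩, RigidExt.isSupersolvable_ker_proj, fun _ =>
    RigidExt.isSolvable⟩
  exact RigidExt.areConjugateSubgroups_of_mulEquiv (by omega) hE hp (fun s => (hp' s).2.1.ne')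
    (fun s => hcop _ (hp' s).1 (hp' s).2.1.le) (hcop q hqp le_rfl) Φ
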